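/- Let $M$ be a $C^\infty$ smooth Hausdorff paracompact $n$-dimensional manifold without boundary and let $1\le r\le\infty$. A (singular) foliation of class $C^r$ on $M$ is a partition $\mathcal F$ of $M$ into subsets, called leaves, possibly of different dimensions, such that: (a) each leaf $L$ is a weakly imbedded submanifold, i.e. $L$ carries a $C^r$-differentiable structure (of some dimension $k$) making it an immersed submanifold of $M$, such that for every locally connected topological space $N$ and every continuous map $f:N\to M$ with $f(N)\subset L$, the map $f:N\to L$ is continuous as well; (b) if $x$ belongs to a $k$-dimensional leaf, then there is a $C^r$ chart $(U,\phi)$ of $M$ with $x\in U$, $\phi(x)=0$ and $\phi(U)=V\times W$, where $V\subset\mathbb R^k$ and $W\subset\mathbb R^{n-k}$ are open, such that $\phi(L\cap U)=V\times\{w\in W:\phi^{-1}(0,w)\in L\}$ for every $L\in\mathcal F$. Let $\mathrm{Diff}^r(M,\mathcal F)$ be the group of all $C^r$ diffeomorphisms $f$ of $M$ with $f(L)=L$ for every leaf $L$. For a group $G$ of $C^r$ diffeomorphisms of $M$ and a set $U\subset M$, let $G_U$ be the group of all $g$ for which there are a compact set $K\subset U$ and a map $\mathbb R\times M\ni(t,x)\mapsto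 f_t(x)\in M$ of class $C^r$ with $f_t\in G$ and $f_t=\mathrm{id}$ off $K$ for all $t$, $f_0=\mathrm{id}$ and $f_1=g$ (the identity component of the group of elements of $G$ compactly supported in $U$). Set $G_{\mathcal F}=\mathrm{Diff}^r_c(M,\mathcal F)_0:=\mathrm{Diff}^r(M,\mathcal F)_M$, i.e. the group of all leaf preserving $C^r$ diffeomorphisms that can be joined to the identity by a compactly supported $C^r$ isotopy of leaf preserving diffeomorphisms. Then, for every foliation $\mathcal F$ of class $C^r$ on $M$, the group $G=G_{\mathcal F}$ is factorizable: for every open cover $\mathcal U$ of $M$ and every $g\in G$ there are finitely many $g_1,\dots,g_m\in G$ and $U_1,\dots,U_m\in\mathcal U$ such that $g=g_1\cdots g_m$ and $g_i\in G_{U_i}$ for $i=1,\dots,m$. -/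

import Mathlib

open scoped Manifold ContDiff

universe u

namespace FoliatedManifold

/-- `C^r` diffeomorphisms of `M` form a group under composition: `(f * g) x = f (g x)`. -/
noncomputable instance instGroupDiffeomorph {n : ℕ} {M : Type u} [TopologicalSpace M]
    [ChartedSpace (EuclideanSpace ℝ (Fin n)) M] {r : ℕ∞ω} :
    Group (Diffeomorph (𝓡 n) (𝓡 n) M M r) where
  mul f g := g.trans f
  one := Diffeomorph.refl (𝓡 n) M r
  inv f := f.symm
  mul_assoc _ _ _ := Diffeomorph.ext fun _ => rfl
  one_mul _ := Diffeomorph.ext fun _ => rfl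
  mul_one _ := Diffeomorph.ext fun _ => rfl
  inv_mul_cancel f := Diffeomorph.ext fun x => f.symm_apply_apply x

section Group

variable {n : ℕ} {M : Type u} [TopologicalSpace M]
  [ChartedSpace (EuclideanSpace ℝ (Fin n)) M] {r : ℕ∞ω}

theorem diffeo_mul_apply (f g : Diffeomorph (𝓡 n) (𝓡 n) M M r) (x : M) :
    (f * g) x = f (g x) := rfl

theorem diffeo_one_apply (x : M) : (1 : Diffeomorph (𝓡 n) (𝓡 n) M M r) x = x := rfl

theorem diffeo_inv_apply (f : Diffeomorph (𝓡 n) (𝓡 n) M M r) (x : M) :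
    f⁻¹ x = f.symm x := rfl

/-- `f = (f_t)` is a `C^r` isotopy through elements of `G`, starting at the identity, with all
`f_t` equal to the identity off the set `K`.  The class `C^r` refers to `(t, x) ↦ f_t(x)`. -/
structure IsIsotopyIn (G : Subgroup (Diffeomorph (𝓡 n) (𝓡 n) M M r)) (K : Set M)
    (f : ℝ → Diffeomorph (𝓡 n) (𝓡 n) M M r) : Prop where
  contMDiff : ContMDiff (𝓘(ℝ, ℝ).prod (𝓡 n)) (𝓡 n) r (fun p : ℝ × M => f p.1 p.2)
  mem : ∀ t, f t ∈ G
  map_zero : f 0 = 1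
  eq_off : ∀ t, ∀ x ∉ K, f t x = x

/-- The identity component `G_U` of the group of elements of `G` compactly supported in `U`:
the end points of isotopies through elements of `G` that start at the identity and are
supported in one compact subset of `U`.  For `U = M` this is the compactly supported
identity component of `G`. -/
noncomputable def isotopyComponent (G : Subgroup (Diffeomorph (𝓡 n) (𝓡 n) M M r)) (U : Set M) :
    Subgroup (Diffeomorph (𝓡 n) (𝓡 n) M M r) where
  carrier := {g | ∃ K : Set M, IsCompact K ∧ K ⊆ U ∧
    ∃ f : ℝ → Diffeomorph (𝓡 n) (𝓡 n) M M r, IsIsotopyIn G K f ∧ f 1 = g}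
  one_mem' := by
    refine ⟨∅, isCompact_empty, Set.empty_subset _, fun _ => 1, ⟨?_, ?_, rfl, ?_⟩, rfl⟩
    · exact contMDiff_snd
    · exact fun _ => G.one_mem
    · exact fun _ _ _ => rfl
  mul_mem' := by
    rintro g g' ⟨K, hK, hKU, f, hf, rfl⟩ ⟨K', hK', hKU', f', hf', rfl⟩
    refine ⟨K ∪ K', hK.union hK', Set.union_subset hKU hKU', fun t => f t * f' t,
      ⟨?_, ?_, ?_, ?_⟩, rfl⟩
    · exact hf.contMDiff.comp (contMDiff_fst.prodMk hf'.contMDiff)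
    · exact fun t => G.mul_mem (hf.mem t) (hf'.mem t)
    · simp [hf.map_zero, hf'.map_zero]
    · intro t x hx
      rw [Set.mem_union, not_or] at hx
      rw [diffeo_mul_apply, hf'.eq_off t x hx.2, hf.eq_off t x hx.1]
  inv_mem' := by
    rintro g ⟨K, hK, hKU, f, hf, rfl⟩
    refine ⟨K, hK, hKU, fun t => f (1 - t) * (f 1)⁻¹, ⟨?_, ?_, ?_, ?_⟩, ?_⟩
    · have h1 : ContMDiff (𝓘(ℝ, ℝ).prod (𝓡 n)) 𝓘(ℝ, ℝ) r (fun p : ℝ × M => 1 - p.1) :=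
        (contDiff_const.sub contDiff_id : ContDiff ℝ r fun t : ℝ => 1 - t).contMDiff.comp
          contMDiff_fst
      exact hf.contMDiff.comp (h1.prodMk ((f 1).symm.contMDiff.comp contMDiff_snd))
    · exact fun t => G.mul_mem (hf.mem _) (G.inv_mem (hf.mem 1))
    · simp
    · intro t x hx
      have h : (f 1)⁻¹ x = x := by
        rw [diffeo_inv_apply]
        conv_lhs => rw [← hf.eq_off 1 x hx]
        exact (f 1).symm_apply_apply x
      rw [diffeo_mul_apply, h, hf.eq_off _ x hx]
    · simp [hf.map_zero]

/-- A group `G` of `C^r` diffeomorphisms is factorizable if, for every open cover, each `g ∈ G` is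
a finite product of elements of the groups `G_U`, with `U` in the cover. -/
def IsFactorizable (G : Subgroup (Diffeomorph (𝓡 n) (𝓡 n) M M r)) : Prop :=
  ∀ 𝒰 : Set (Set M), (∀ U ∈ 𝒰, IsOpen U) → ⋃₀ 𝒰 = Set.univ →
    ∀ g ∈ G, ∃ l : List (Diffeomorph (𝓡 n) (𝓡 n) M M r),
      (∀ h ∈ l, ∃ U ∈ 𝒰, h ∈ isotopyComponent G U) ∧ l.prod = g

end Group

section Foliation

variable {n : ℕ} {M : Type u} [TopologicalSpace M]
  [ChartedSpace (EuclideanSpace ℝ (Fin n)) M]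

/-- `L ⊆ M` carries a `C^r` structure of dimension `k` (presented as the image of an injective
immersion `ι : S → M` of a `C^r` manifold `S`) for which it is a weakly imbedded submanifold: every
map from a locally connected space to `L` that is continuous into `M` is continuous into `L`.
Spaces `N` in the universe of `M` suffice: for a map `f` from a larger space, give the
set `L` the topology coinduced by `f`, which is again locally connected. -/
def IsWeaklyImbedded (r : ℕ∞ω) (k : ℕ) (L : Set M) : Prop :=
  ∃ (S : Type u) (_ : TopologicalSpace S) (_ : ChartedSpace (EuclideanSpace ℝ (Fin k)) S)
    (_ : IsManifold (𝓡 k) r S) (ι : S → M),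
    Function.Injective ι ∧ Set.range ι = L ∧ Manifold.IsImmersion (𝓡 k) (𝓡 n) r ι ∧
    ∀ (N : Type u) [TopologicalSpace N] [LocallyConnectedSpace N] (f : N → S),
      Continuous (ι ∘ f) → Continuous f

/-- At `x` there is a `C^r` chart `φ` of `M` with values in `ℝ^k × ℝ^(n-k)` that is distinguished
for the partition `𝓛`: it is centred at `x`, its image is a product `V × W`, and every `L` in
`𝓛` appears in it as `V × l` with `l = {w ∈ W | φ⁻¹(0, w) ∈ L}`. -/
def HasDistinguishedChart (r : ℕ∞ω) (k : ℕ) (𝓛 : Set (Set M)) (x : M) : Prop :=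
  ∃ φ : OpenPartialHomeomorph M
      (EuclideanSpace ℝ (Fin k) × EuclideanSpace ℝ (Fin (n - k))),
    ContMDiffOn (𝓡 n) 𝓘(ℝ, EuclideanSpace ℝ (Fin k) × EuclideanSpace ℝ (Fin (n - k))) r
      φ φ.source ∧
    ContMDiffOn 𝓘(ℝ, EuclideanSpace ℝ (Fin k) × EuclideanSpace ℝ (Fin (n - k))) (𝓡 n) r
      φ.symm φ.target ∧
    x ∈ φ.source ∧ φ x = 0 ∧
    ∃ (V : Set (EuclideanSpace ℝ (Fin k))) (W : Set (EuclideanSpace ℝ (Fin (n - k)))),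
      IsOpen V ∧ IsOpen W ∧ φ.target = V ×ˢ W ∧
      ∀ L ∈ 𝓛, φ '' (L ∩ φ.source) = V ×ˢ {w ∈ W | φ.symm (0, w) ∈ L}

variable (n M) in
/-- A (singular) foliation of class `C^r`: a partition of `M` into weakly imbedded submanifolds,
the leaves, possibly of different dimensions, with a distinguished chart at each point. -/
structure Foliation (r : ℕ∞ω) where
  leaves : Set (Set M)
  isPartition : Setoid.IsPartition leaves
  exists_dim : ∀ L ∈ leaves, ∃ k : ℕ, IsWeaklyImbedded (n := n) r k L ∧
    ∀ x ∈ L, HasDistinguishedChart (n := n) r k leaves x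

variable {r : ℕ∞ω}

/-- The group `Diff^r(M, F)` of leaf preserving `C^r` diffeomorphisms: `f(L) = L` for
every leaf `L`. -/
noncomputable def Foliation.leafPreserving (F : Foliation n M r) :
    Subgroup (Diffeomorph (𝓡 n) (𝓡 n) M M r) where
  carrier := {f | ∀ L ∈ F.leaves, f '' L = L}
  one_mem' := fun L _ => Set.image_id L
  mul_mem' := by
    intro f g hf hg L hL
    have h : ⇑(f * g) = f ∘ g := rfl
    rw [h, Set.image_comp, hg L hL, hf L hL]
  inv_mem' := by
    intro f hf L hL
    have h : ⇑f⁻¹ = ⇑f.symm := rfl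
    rw [h]
    conv_lhs => rw [← hf L hL]
    exact f.symm_image_image L

/-- The group `G_F = Diff^r_c(M, F)_0` of the leaf preserving diffeomorphisms that can be joined to
the identity by a compactly supported isotopy of leaf preserving diffeomorphisms. -/
noncomputable def Foliation.group (F : Foliation n M r) : Subgroup (Diffeomorph (𝓡 n) (𝓡 n) M M r) :=
  isotopyComponent F.leafPreserving Set.univ

end Foliation

end FoliatedManifold

/-! Let `H` be generated by the subgroups supported in members of the cover. Along an isotopy `f`,
the coset `H f_t` turns out to be locally constant in `t`, so connectedness of `ℝ` gives `f_1 ∈ H`.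
Recentring, it suffices that `g_τ ∈ H` for small `τ` when `g_0 = id`. For this, slow the isotopy
down pointwise: a cutoff `ψ` gives the map `x ↦ g_{τψ(x)}(x)`. It sends each leaf into itself
because every `g_t` does, and for small `τ` it is a diffeomorphism, by the inverse function theorem
and compactness (`exists_diffeomorph_family`). Changing `ψ` by a bump supported in `U` changes this
diffeomorphism by a factor supported in `U` (`Foliation.eventually_exists_mul_of_cutoff`). Finitely
many such changes lead from `ψ = 0` to a `ψ` equal to `1` on the support of `g`. -/

namespace FoliatedManifold
open Set Filter Topology

/-! ### Inverse function theorem with a time parameter -/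

section LocalInverse

variable {n : ℕ} {M : Type u} [TopologicalSpace M]
  [ChartedSpace (EuclideanSpace ℝ (Fin n)) M] {r : ℕ∞ω}

/-- The inverse function theorem for a family of self-maps of a normed space, starting at the
identity. -/
theorem exists_openPartialHomeomorph_of_family {E : Type*} [NormedAddCommGroup E]
    [NormedSpace ℝ E] [CompleteSpace E] (hr : r ≠ 0) {φ : ℝ × E → E} {O : Set (ℝ × E)}
    (hO : IsOpen O) (hφ : ContDiffOn ℝ r φ O) {u₀ : E} (hu₀ : (0, u₀) ∈ O)
    (hid : ∀ᶠ u in 𝓝 u₀, φ (0, u) = u) :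
    ∃ e : OpenPartialHomeomorph (ℝ × E) (ℝ × E), (0, u₀) ∈ e.source ∧ e.source ⊆ O ∧
      (∀ p, e p = (p.1, φ p)) ∧ ContDiffOn ℝ r e.symm e.target := by
  set Θ : ℝ × E → ℝ × E := fun p => (p.1, φ p) with hΘ
  have hΘc : ContDiffOn ℝ r Θ O := contDiff_fst.contDiffOn.prodMk hφ
  have hat : ∀ p ∈ O, ContDiffAt ℝ r Θ p := fun p hp => hΘc.contDiffAt (hO.mem_nhds hp)
  have hφd : HasFDerivAt φ (fderiv ℝ φ (0, u₀)) (0, u₀) :=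
    ((hφ.contDiffAt (hO.mem_nhds hu₀)).differentiableAt hr).hasFDerivAt
  set A := fderiv ℝ φ (0, u₀) with hA
  have hA2 : ∀ b : E, A (0, b) = b := by
    have h1 : HasFDerivAt (fun u : E => φ (0, u))
        (A.comp (ContinuousLinearMap.inr ℝ ℝ E)) u₀ :=
      HasFDerivAt.comp u₀ hφd (hasFDerivAt_prodMk_right (0 : ℝ) u₀)
    have h2 : HasFDerivAt (fun u : E => φ (0, u)) (ContinuousLinearMap.id ℝ E) u₀ :=
      (hasFDerivAt_id u₀).congr_of_eventuallyEq hid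
    intro b
    simpa using DFunLike.congr_fun (h1.unique h2) b
  -- The derivative of `Θ` at the base point is block triangular with identity diagonal blocks,
  -- hence invertible.
  let T : (ℝ × E) ≃L[ℝ] (ℝ × E) :=
    ContinuousLinearEquiv.skewProd (ContinuousLinearEquiv.refl ℝ ℝ)
      (ContinuousLinearEquiv.refl ℝ E) (A.comp (ContinuousLinearMap.inl ℝ ℝ E))
  have hT : HasFDerivAt Θ (T : (ℝ × E) →L[ℝ] (ℝ × E)) (0, u₀) := by
    have h := (hasFDerivAt_fst (𝕜 := ℝ) (p := ((0 : ℝ), u₀))).prodMk hφd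
    refine h.congr_fderiv ?_
    ext1
    · ext <;> simp [T]
    · ext b <;> simp [T, hA2]
  let e₀ := (hat _ hu₀).toOpenPartialHomeomorph Θ hT hr
  have he₀ : (0, u₀) ∈ e₀.source :=
    ContDiffAt.mem_toOpenPartialHomeomorph_source (hat _ hu₀) hT hr
  -- Regularity of the inverse on the whole target needs an invertible derivative at every source
  -- point, so the source is shrunk.
  have hinv : ∀ᶠ p in 𝓝 ((0 : ℝ), u₀), ∃ B : (ℝ × E) ≃L[ℝ] (ℝ × E), ↑B = fderiv ℝ Θ p := by
    have hc : ContinuousAt (fderiv ℝ Θ) (0, u₀) :=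
      ((hΘc.continuousOn_fderiv_of_isOpen hO
        (ENat.one_le_iff_ne_zero_withTop.2 hr)).continuousAt (hO.mem_nhds hu₀))
    have := ContinuousLinearEquiv.nhds T
    rw [← hT.fderiv] at this
    exact hc this
  obtain ⟨Q, hQ, hQo, hQm⟩ := eventually_nhds_iff.1 (hinv.and (hO.mem_nhds hu₀))
  refine ⟨e₀.restrOpen Q hQo, ⟨he₀, hQm⟩, fun p hp => (hQ p hp.2).2, fun p => rfl, ?_⟩
  intro q hq
  have hq' := (e₀.restrOpen Q hQo).map_target hq
  obtain ⟨B, hB⟩ := (hQ _ hq'.2).1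
  have hd := hat _ (hQ _ hq'.2).2
  refine ContDiffAt.contDiffWithinAt
    ((e₀.restrOpen Q hQo).contDiffAt_symm (f₀' := B) hq ?_ hd)
  rw [hB]
  exact (hd.differentiableAt hr).hasFDerivAt

end LocalInverse

/-! ### Local inverses on the manifold -/

section Family

variable {n : ℕ} {M : Type u} [TopologicalSpace M]
  [ChartedSpace (EuclideanSpace ℝ (Fin n)) M] {r : ℕ∞ω} [IsManifold (𝓡 n) r M]
  {Φ : ℝ × M → M}

/-- Near the identity, a `C^r` family of maps is injective and has a `C^r` family of local
inverses. -/
theorem eventually_injective_and_exists_localInverse (hr : r ≠ 0)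
    (hΦ : ContMDiff (𝓘(ℝ, ℝ).prod (𝓡 n)) (𝓡 n) r Φ) (h0 : ∀ x, Φ (0, x) = x) (x₀ : M) :
    (∀ᶠ q : ℝ × M × M in 𝓝 (0, x₀, x₀),
      Φ (q.1, q.2.1) = Φ (q.1, q.2.2) → q.2.1 = q.2.2) ∧
    ∃ G : ℝ × M → M, ∀ᶠ p in 𝓝 ((0 : ℝ), x₀),
      ContMDiffAt (𝓘(ℝ, ℝ).prod (𝓡 n)) (𝓡 n) r G p ∧ Φ (p.1, G p) = p.2 := by
  set c := extChartAt (𝓡 n) x₀ with hc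
  have hcs : IsOpen c.source := isOpen_extChartAt_source x₀
  have hct : IsOpen c.target := isOpen_extChartAt_target x₀
  have hcc : ContMDiffOn (𝓡 n) 𝓘(ℝ, EuclideanSpace ℝ (Fin n)) r c c.source := by
    rw [hc, extChartAt_source]; exact contMDiffOn_extChartAt
  have hcsym : ContMDiffOn 𝓘(ℝ, EuclideanSpace ℝ (Fin n)) (𝓡 n) r c.symm c.target :=
    contMDiffOn_extChartAt_symm x₀
  set ψ : ℝ × EuclideanSpace ℝ (Fin n) → M := fun p => Φ (p.1, c.symm p.2) with hψ
  have hψc : ContMDiffOn 𝓘(ℝ, ℝ × EuclideanSpace ℝ (Fin n)) (𝓡 n) r ψ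
      (univ ×ˢ c.target) := by
    refine hΦ.comp_contMDiffOn (contDiff_fst.contMDiff.contMDiffOn.prodMk ?_)
    exact hcsym.comp contDiff_snd.contMDiff.contMDiffOn fun p hp => hp.2
  set O : Set (ℝ × EuclideanSpace ℝ (Fin n)) :=
    (univ ×ˢ c.target) ∩ ψ ⁻¹' c.source with hOdef
  have hO : IsOpen O := hψc.continuousOn.isOpen_inter_preimage (isOpen_univ.prod hct) hcs
  have hx₀ : x₀ ∈ c.source := mem_extChartAt_source x₀
  have hu₀ : ((0 : ℝ), c x₀) ∈ O := by
    refine ⟨⟨mem_univ _, c.map_source hx₀⟩, ?_⟩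
    simp only [hψ, mem_preimage, h0]
    rwa [c.left_inv hx₀]
  have hφ : ContDiffOn ℝ r (c ∘ ψ) O :=
    (hcc.comp (hψc.mono inter_subset_left) fun p hp => hp.2).contDiffOn
  obtain ⟨e, hes, heO, he, hesym⟩ := exists_openPartialHomeomorph_of_family hr hO hφ hu₀ (by
    filter_upwards [hct.mem_nhds (c.map_source hx₀)] with u hu
    simp only [hψ, Function.comp, h0]
    exact c.right_inv hu)
  constructor
  · have hk : ContinuousAt (fun p : ℝ × M => (p.1, c p.2)) (0, x₀) :=
      continuousAt_fst.prodMk (ContinuousAt.comp (x := ((0 : ℝ), x₀)) (g := c) (f := Prod.snd)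
        (continuousAt_extChartAt x₀) continuousAt_snd)
    have hN : ∀ᶠ p : ℝ × M in 𝓝 (0, x₀), (p.1, c p.2) ∈ e.source ∧ p.2 ∈ c.source :=
      (hk.eventually (e.open_source.mem_nhds hes)).and (continuousAt_snd.eventually (hcs.mem_nhds hx₀))
    have h1 : ContinuousAt (fun q : ℝ × M × M => (q.1, q.2.1)) (0, x₀, x₀) := by fun_prop
    have h2 : ContinuousAt (fun q : ℝ × M × M => (q.1, q.2.2)) (0, x₀, x₀) := by fun_prop
    filter_upwards [h1.eventually hN, h2.eventually hN] with q hq1 hq2 hq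
    have := e.injOn hq1.1 hq2.1 (by
      simp only [he, hψ, Function.comp, c.left_inv hq1.2, c.left_inv hq2.2, hq])
    exact c.injOn hq1.2 hq2.2 (Prod.ext_iff.1 this).2
  · refine ⟨fun p => c.symm (e.symm (p.1, c p.2)).2, ?_⟩
    have hkc : ContMDiffOn (𝓘(ℝ, ℝ).prod (𝓡 n)) 𝓘(ℝ, ℝ × EuclideanSpace ℝ (Fin n)) r
        (fun p : ℝ × M => (p.1, c p.2)) (univ ×ˢ c.source) := by
      exact contMDiffOn_fst.prodMk_space (hcc.comp contMDiffOn_snd fun p hp => hp.2)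
    have hN : IsOpen ((univ ×ˢ c.source) ∩ (fun p : ℝ × M => (p.1, c p.2)) ⁻¹' e.target) :=
      hkc.continuousOn.isOpen_inter_preimage (isOpen_univ.prod hcs) e.open_target
    have hmem : ((0 : ℝ), x₀) ∈
        (univ ×ˢ c.source) ∩ (fun p : ℝ × M => (p.1, c p.2)) ⁻¹' e.target := by
      refine ⟨⟨mem_univ _, hx₀⟩, ?_⟩
      have := e.map_source hes
      simp only [he, hψ, Function.comp, h0] at this
      rwa [c.right_inv (c.map_source hx₀)] at this
    filter_upwards [hN.mem_nhds hmem] with p hp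
    have hes' := e.map_target hp.2
    have hO' := heO hes'
    constructor
    · have h3 : ContMDiffOn (𝓘(ℝ, ℝ).prod (𝓡 n)) 𝓘(ℝ, ℝ × EuclideanSpace ℝ (Fin n)) r
          (fun p : ℝ × M => e.symm (p.1, c p.2)) _ :=
        hesym.contMDiffOn.comp (hkc.mono inter_subset_left) fun p hp => hp.2
      have h4 : ContMDiffOn (𝓘(ℝ, ℝ).prod (𝓡 n)) 𝓘(ℝ, EuclideanSpace ℝ (Fin n)) r
          (fun p : ℝ × M => (e.symm (p.1, c p.2)).2) _ :=
        (contDiff_snd.contMDiff (n := r)).comp_contMDiffOn h3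
      exact (hcsym.comp h4 fun p hp =>
        (heO (e.map_target hp.2)).1.2).contMDiffAt (hN.mem_nhds hp)
    · have h5 := e.right_inv hp.2
      rw [he] at h5
      obtain ⟨h6, h7⟩ := Prod.ext_iff.1 h5
      simp only at h6 h7
      have h8 := c.injOn hO'.2 hp.1.2 h7
      simp only [hψ] at h8
      rwa [h6] at h8

end Family

/-! ### From local to global inverses by compactness -/

section Global

variable {n : ℕ} {M : Type u} [TopologicalSpace M]
  [ChartedSpace (EuclideanSpace ℝ (Fin n)) M] {r : ℕ∞ω} [IsManifold (𝓡 n) r M]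
  {Φ : ℝ × M → M}

/-- The members close to the identity of a compactly supported `C^r` family of maps are
bijective, and the family of their inverses is locally given by `C^r` maps. -/
theorem eventually_bijective_and_exists_localInverse [T2Space M] (hr : r ≠ 0)
    (hΦ : ContMDiff (𝓘(ℝ, ℝ).prod (𝓡 n)) (𝓡 n) r Φ) (h0 : ∀ x, Φ (0, x) = x)
    {K : Set M} (hK : IsCompact K) (hoff : ∀ t, ∀ x ∉ K, Φ (t, x) = x) :
    ∀ᶠ t in 𝓝 (0 : ℝ), Function.Bijective (fun x => Φ (t, x)) ∧
      ∀ y, ∃ G : ℝ × M → M, ContMDiffAt (𝓘(ℝ, ℝ).prod (𝓡 n)) (𝓡 n) r G (t, y) ∧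
        ∀ᶠ p in 𝓝 (t, y), Φ (p.1, G p) = p.2 := by
  have := Manifold.locallyCompact_of_finiteDimensional (M := M) (𝓡 n)
  obtain ⟨K', hK', hKK'⟩ := exists_compact_superset hK
  have hloc : ∀ᶠ t in 𝓝 (0 : ℝ), ∀ y ∈ K,
      ∃ G : ℝ × M → M, ContMDiffAt (𝓘(ℝ, ℝ).prod (𝓡 n)) (𝓡 n) r G (t, y) ∧
        ∀ᶠ p in 𝓝 (t, y), Φ (p.1, G p) = p.2 := by
    refine hK.eventually_forall_of_forall_eventually fun y _ => ?_
    obtain ⟨G, hG⟩ := (eventually_injective_and_exists_localInverse hr hΦ h0 y).2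
    filter_upwards [eventually_eventually_nhds.2 hG] with p hp
    exact ⟨G, hp.self_of_nhds.1, hp.mono fun q hq => hq.2⟩
  -- A point outside `K` sharing its image with a point of `K` must then lie in `K'`, so injectivity
  -- need only be tested on the compact set `K' ×ˢ K'`.
  have hmaps : ∀ᶠ t in 𝓝 (0 : ℝ), ∀ x ∈ K, Φ (t, x) ∈ K' := by
    refine hK.eventually_forall_of_forall_eventually fun x hx => ?_
    refine (hΦ.continuous.continuousAt (x := (0, x))).eventually (p := (· ∈ K')) ?_
    rw [h0]
    exact mem_interior_iff_mem_nhds.1 (hKK' hx)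
  have hinj : ∀ᶠ t in 𝓝 (0 : ℝ), ∀ q ∈ K' ×ˢ K', Φ (t, q.1) = Φ (t, q.2) → q.1 = q.2 := by
    refine (hK'.prod hK').eventually_forall_of_forall_eventually
      (P := fun t q => Φ (t, q.1) = Φ (t, q.2) → q.1 = q.2) ?_
    rintro ⟨x, y⟩ -
    by_cases hxy : x = y
    · subst hxy
      exact (eventually_injective_and_exists_localInverse hr hΦ h0 x).1
    · have hc := hΦ.continuous
      have h1 : ContinuousAt (fun q : ℝ × M × M => Φ (q.1, q.2.1)) (0, x, y) := by fun_prop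
      have h2 : ContinuousAt (fun q : ℝ × M × M => Φ (q.1, q.2.2)) (0, x, y) := by fun_prop
      have h3 : ∀ᶠ q : ℝ × M × M in 𝓝 (0, x, y), Φ (q.1, q.2.1) ≠ Φ (q.1, q.2.2) :=
        (h1.ne_iff_eventually_ne h2).1 (by simpa only [h0] using hxy)
      exact h3.mono fun q hq h => absurd h hq
  filter_upwards [hloc, hmaps, hinj] with t h1 h2 h3
  have hmix : ∀ x y, y ∉ K → Φ (t, x) = Φ (t, y) → x = y := by
    intro x y hy hxy
    by_cases hx : x ∈ K
    · refine h3 (x, y) ⟨interior_subset (hKK' hx), ?_⟩ hxy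
      rw [hoff t y hy] at hxy
      exact hxy ▸ h2 x hx
    · rwa [hoff t x hx, hoff t y hy] at hxy
  refine ⟨⟨fun x y hxy => ?_, fun y => ?_⟩, fun y => ?_⟩
  · by_cases hy : y ∈ K
    · by_cases hx : x ∈ K
      · exact h3 (x, y) ⟨interior_subset (hKK' hx), interior_subset (hKK' hy)⟩ hxy
      · exact (hmix y x hx hxy.symm).symm
    · exact hmix x y hy hxy
  · by_cases hy : y ∈ K
    · obtain ⟨G, -, hG⟩ := h1 y hy
      exact ⟨G (t, y), hG.self_of_nhds⟩
    · exact ⟨y, hoff t y hy⟩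
  · by_cases hy : y ∈ K
    · exact h1 y hy
    · refine ⟨Prod.snd, contMDiffAt_snd, ?_⟩
      filter_upwards [continuousAt_snd.eventually (hK.isClosed.isOpen_compl.mem_nhds hy)]
        with p hp using hoff p.1 p.2 hp

/-- Short compactly supported `C^r` families of maps starting at the identity are families of
diffeomorphisms whose inverses form a `C^r` family. -/
theorem exists_diffeomorph_family [T2Space M] (hr : r ≠ 0)
    (hΦ : ContMDiff (𝓘(ℝ, ℝ).prod (𝓡 n)) (𝓡 n) r Φ) (h0 : ∀ x, Φ (0, x) = x)
    {K : Set M} (hK : IsCompact K) (hoff : ∀ t, ∀ x ∉ K, Φ (t, x) = x) :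
    ∃ δ > 0, ∀ σ : ℝ → ℝ, ContDiff ℝ r σ → (∀ s, |σ s| < δ) →
      ∃ F : ℝ → Diffeomorph (𝓡 n) (𝓡 n) M M r, (∀ s x, F s x = Φ (σ s, x)) ∧
        ContMDiff (𝓘(ℝ, ℝ).prod (𝓡 n)) (𝓡 n) r (fun p : ℝ × M => (F p.1)⁻¹ p.2) := by
  obtain ⟨δ, hδ, h⟩ := Metric.eventually_nhds_iff.1
    (eventually_bijective_and_exists_localInverse hr hΦ h0 hK hoff)
  refine ⟨δ, hδ, fun σ hσ hσδ => ?_⟩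
  have h' : ∀ s, _ := fun s => h (y := σ s) (by simpa using hσδ s)
  let e : ℝ → M ≃ M := fun s => Equiv.ofBijective _ (h' s).1
  have he : ∀ s x, e s x = Φ (σ s, x) := fun s x => rfl
  have hinv : ContMDiff (𝓘(ℝ, ℝ).prod (𝓡 n)) (𝓡 n) r
      (fun p : ℝ × M => (e p.1).symm p.2) := by
    rintro ⟨s, y⟩
    obtain ⟨G, hG, hGy⟩ := (h' s).2 y
    have hk : ContMDiff (𝓘(ℝ, ℝ).prod (𝓡 n)) (𝓘(ℝ, ℝ).prod (𝓡 n)) r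
        (fun p : ℝ × M => (σ p.1, p.2)) :=
      (hσ.contMDiff.comp contMDiff_fst).prodMk contMDiff_snd
    refine (ContMDiffAt.comp (s, y) (g := G) (f := fun p : ℝ × M => (σ p.1, p.2)) hG
      (hk (s, y))).congr_of_eventuallyEq ?_
    filter_upwards [(hk.continuous.continuousAt (x := (s, y))).eventually hGy] with p hp
    rw [Equiv.symm_apply_eq, he]
    exact hp.symm
  refine ⟨fun s => ⟨e s, ?_, ?_⟩, fun s x => rfl, hinv⟩
  · exact hΦ.comp (contMDiff_const.prodMk contMDiff_id)
  · exact hinv.comp (contMDiff_const.prodMk contMDiff_id)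

end Global

/-! ### Fragmentation of leaf preserving isotopies -/

section Fragmentation

variable {n : ℕ} {M : Type u} [TopologicalSpace M]
  [ChartedSpace (EuclideanSpace ℝ (Fin n)) M] {r : ℕ∞ω}

theorem IsIsotopyIn.mem_isotopyComponent {G : Subgroup (Diffeomorph (𝓡 n) (𝓡 n) M M r)}
    {K U : Set M} {f : ℝ → Diffeomorph (𝓡 n) (𝓡 n) M M r} (hf : IsIsotopyIn G K f)
    (hK : IsCompact K) (hKU : K ⊆ U) (t : ℝ) : f t ∈ isotopyComponent G U := by
  refine ⟨K, hK, hKU, fun s => f (s * t), ⟨?_, fun s => hf.mem _, ?_, fun s => hf.eq_off _⟩, ?_⟩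
  · have h : ContMDiff (𝓘(ℝ, ℝ).prod (𝓡 n)) 𝓘(ℝ, ℝ) r (fun p : ℝ × M => p.1 * t) :=
      (contDiff_id.mul contDiff_const : ContDiff ℝ r fun s : ℝ => s * t).contMDiff.comp
        contMDiff_fst
    exact hf.contMDiff.comp (h.prodMk contMDiff_snd)
  · simp [hf.map_zero]
  · simp

/-- Every stage of an isotopy is itself an endpoint, by rescaling time, so the isotopy already runs
inside the identity component. Factorizability of `F.group` asks for isotopies there. -/
theorem isotopyComponent_le_isotopyComponent_isotopyComponent
    (G : Subgroup (Diffeomorph (𝓡 n) (𝓡 n) M M r)) (U : Set M) :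
    isotopyComponent G U ≤ isotopyComponent (isotopyComponent G univ) U := by
  rintro g ⟨K, hK, hKU, f, hf, rfl⟩
  exact ⟨K, hK, hKU, f, ⟨hf.contMDiff,
    fun t => hf.mem_isotopyComponent hK (subset_univ _) t, hf.map_zero, hf.eq_off⟩, rfl⟩

/-- A preimage of a point of `L` lies in some leaf, which is mapped into itself and so meets `L`;
disjointness makes it `L`. -/
theorem Foliation.mem_leafPreserving_of_forall_mem (F : Foliation n M r)
    {f : Diffeomorph (𝓡 n) (𝓡 n) M M r} (h : ∀ L ∈ F.leaves, ∀ x ∈ L, f x ∈ L) :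
    f ∈ F.leafPreserving := by
  intro L hL
  refine Subset.antisymm (image_subset_iff.2 (h L hL)) fun y hy => ?_
  obtain ⟨x, rfl⟩ := f.surjective y
  obtain ⟨L', ⟨hL', hx⟩, -⟩ := F.isPartition.2 x
  obtain rfl := (F.isPartition.2 (f x)).unique ⟨hL, hy⟩ ⟨hL', h L' hL' x hx⟩
  exact ⟨x, hx, rfl⟩

variable [IsManifold (𝓡 n) r M] [T2Space M]

/-- If `ψ` and `ψ'` differ only on a compact set `C ⊆ U`, then for small `τ` the diffeomorphisms
`x ↦ g_{τψ(x)}(x)` and `x ↦ g_{τψ'(x)}(x)` differ by an element supported in `U`. -/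
theorem Foliation.eventually_exists_mul_of_cutoff (F : Foliation n M r) (hr : r ≠ 0)
    (hrω : r ≤ ∞) {K : Set M} (hK : IsCompact K) {g : ℝ → Diffeomorph (𝓡 n) (𝓡 n) M M r}
    (hg : IsIsotopyIn F.leafPreserving K g) {ψ ψ' : M → ℝ} (hψ : ContMDiff (𝓡 n) 𝓘(ℝ, ℝ) r ψ)
    (hψ' : ContMDiff (𝓡 n) 𝓘(ℝ, ℝ) r ψ') {C U : Set M} (hC : IsCompact C) (hU : IsOpen U)
    (hCU : C ⊆ U) (heq : ∀ x ∉ C, ψ' x = ψ x) :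
    ∀ᶠ τ in 𝓝 (0 : ℝ), ∃ e ∈ isotopyComponent F.leafPreserving U,
      ∀ d : Diffeomorph (𝓡 n) (𝓡 n) M M r, (∀ x, d x = g (τ * ψ x) x) →
        ∀ x, (e * d) x = g (τ * ψ' x) x := by
  have key : ∀ χ : M → ℝ, ContMDiff (𝓡 n) 𝓘(ℝ, ℝ) r χ →
      ContMDiff (𝓘(ℝ, ℝ).prod (𝓡 n)) (𝓡 n) r (fun p : ℝ × M => g (p.1 * χ p.2) p.2) ∧
      ∃ δ > 0, ∀ σ : ℝ → ℝ, ContDiff ℝ r σ → (∀ s, |σ s| < δ) →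
      ∃ F : ℝ → Diffeomorph (𝓡 n) (𝓡 n) M M r, (∀ s x, F s x = g (σ s * χ x) x) ∧
        ContMDiff (𝓘(ℝ, ℝ).prod (𝓡 n)) (𝓡 n) r (fun p : ℝ × M => (F p.1)⁻¹ p.2) := by
    intro χ hχ
    have h1 : ContMDiff (𝓘(ℝ, ℝ).prod (𝓡 n)) 𝓘(ℝ, ℝ) r (fun p : ℝ × M => p.1 * χ p.2) :=
      (contDiff_mul (𝕜 := ℝ) (𝔸 := ℝ)).contMDiff.comp
        (contMDiff_fst.prodMk_space (hχ.comp contMDiff_snd))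
    have h2 := hg.contMDiff.comp (h1.prodMk contMDiff_snd)
    refine ⟨h2, ?_⟩
    exact exists_diffeomorph_family hr h2 (fun x => by simp [hg.map_zero, diffeo_one_apply]) hK
      fun t x hx => hg.eq_off _ x hx
  obtain ⟨hc, δ, hδ, hfam⟩ := key ψ hψ
  obtain ⟨hc', δ', hδ', hfam'⟩ := key ψ' hψ'
  have hmaps : ∀ᶠ t in 𝓝 (0 : ℝ), ∀ x ∈ C, g (t * ψ x) x ∈ U := by
    refine hC.eventually_forall_of_forall_eventually fun x hx => ?_
    refine (hc.continuous.continuousAt (x := (0, x))).eventually (p := (· ∈ U)) ?_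
    simpa [hg.map_zero, diffeo_one_apply] using hU.mem_nhds (hCU hx)
  obtain ⟨δ₁, hδ₁, hmaps⟩ := Metric.eventually_nhds_iff.1 hmaps
  refine Metric.eventually_nhds_iff.2 ⟨min δ (min δ' δ₁), by positivity, fun τ hτ => ?_⟩
  have hτ' : |τ| < δ ∧ |τ| < δ' ∧ |τ| < δ₁ := by simpa using hτ
  -- A time change from `0` at `s = 0` to `τ` at `s = 1` that stays in the admissible range for all
  -- real `s`.
  have hσ : ContDiff ℝ r (fun s => τ * Real.smoothTransition s) :=
    contDiff_const.mul (Real.smoothTransition.contDiff.of_le hrω)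
  have hσle : ∀ s, |τ * Real.smoothTransition s| ≤ |τ| := fun s => by
    rw [abs_mul, abs_of_nonneg (Real.smoothTransition.nonneg s)]
    exact mul_le_of_le_one_right (abs_nonneg _) (Real.smoothTransition.le_one s)
  obtain ⟨A, hA, hAi⟩ := hfam _ hσ fun s => (hσle s).trans_lt hτ'.1
  obtain ⟨B, hB, -⟩ := hfam' _ hσ fun s => (hσle s).trans_lt hτ'.2.1
  have hleaf : ∀ t, ∀ L ∈ F.leaves, ∀ x ∈ L, g t x ∈ L := fun t L hL x hx =>
    (hg.mem t L hL).subset (mem_image_of_mem _ hx)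
  -- `B s * (A s)⁻¹` can move `y` only if `(A s)⁻¹ y ∈ C`, so its support lies in what `C` sweeps
  -- out under the `ψ`-family.
  set D : Set M := (fun p : ℝ × M => g (p.1 * ψ p.2) p.2) '' (Icc (-|τ|) |τ| ×ˢ C)
  have hDc : IsCompact D := (isCompact_Icc.prod hC).image hc.continuous
  have hDU : D ⊆ U := by
    rintro _ ⟨⟨t, x⟩, ⟨ht, hx⟩, rfl⟩
    exact hmaps (by simpa using (abs_le.2 ht).trans_lt hτ'.2.2) x hx
  refine ⟨B 1 * (A 1)⁻¹, ⟨D, hDc, hDU, fun s => B s * (A s)⁻¹, ⟨?_, ?_, ?_, ?_⟩, rfl⟩, ?_⟩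
  · have hBc : ContMDiff (𝓘(ℝ, ℝ).prod (𝓡 n)) (𝓡 n) r (fun p : ℝ × M => B p.1 p.2) := by
      simp only [hB]
      exact hc'.comp ((hσ.contMDiff.comp contMDiff_fst).prodMk contMDiff_snd)
    exact hBc.comp (contMDiff_fst.prodMk hAi)
  · refine fun s => mul_mem (F.mem_leafPreserving_of_forall_mem fun L hL x hx => ?_)
      (inv_mem (F.mem_leafPreserving_of_forall_mem fun L hL x hx => ?_))
    · rw [hB]; exact hleaf _ L hL x hx
    · rw [hA]; exact hleaf _ L hL x hx
  · rw [mul_inv_eq_one]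
    exact Diffeomorph.ext fun x => by simp [hA, hB]
  · intro s y hy
    obtain ⟨x, rfl : A s x = y⟩ := (A s).surjective y
    have hx : x ∉ C := fun hx => hy
      ⟨(τ * Real.smoothTransition s, x), ⟨abs_le.1 (hσle s), hx⟩, (hA s x).symm⟩
    rw [diffeo_mul_apply, diffeo_inv_apply, Diffeomorph.symm_apply_apply, hA, hB, heq x hx]
  · intro d hd x
    have : d = A 1 := Diffeomorph.ext fun x => by simp [hA, hd]
    rw [this, inv_mul_cancel_right, hB]
    simp

theorem Foliation.eventually_mem_of_forall_isotopyComponent_le [IsManifold (𝓡 n) ∞ M]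
    (F : Foliation n M r) (hr : r ≠ 0) (hrω : r ≤ ∞)
    {𝒰 : Set (Set M)} (h𝒰 : ∀ U ∈ 𝒰, IsOpen U) (hcov : ⋃₀ 𝒰 = univ)
    {H : Subgroup (Diffeomorph (𝓡 n) (𝓡 n) M M r)}
    (hH : ∀ U ∈ 𝒰, isotopyComponent F.leafPreserving U ≤ H)
    {K : Set M} (hK : IsCompact K) {g : ℝ → Diffeomorph (𝓡 n) (𝓡 n) M M r}
    (hg : IsIsotopyIn F.leafPreserving K g) : ∀ᶠ τ in 𝓝 (0 : ℝ), g τ ∈ H := by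
  let good : (M → ℝ) → Prop := fun ψ => ContMDiff (𝓡 n) 𝓘(ℝ, ℝ) r ψ ∧
    ∀ᶠ τ in 𝓝 (0 : ℝ), ∃ d ∈ H, ∀ x, d x = g (τ * ψ x) x
  -- Quantifying over the initial `ψ` and keeping the set where it equals `1` lets the steps for two
  -- pieces of `K` be chained.
  have main : ∀ ψ, good ψ → ∃ ψ', good ψ' ∧ (∀ x ∈ K, ψ' x = 1) ∧ ∀ x, ψ x = 1 → ψ' x = 1 := by
    refine hK.induction_on
      (p := fun s => ∀ ψ, good ψ → ∃ ψ', good ψ' ∧ (∀ x ∈ s, ψ' x = 1) ∧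
        ∀ x, ψ x = 1 → ψ' x = 1) ?_ ?_ ?_ ?_
    · exact fun ψ hψ => ⟨ψ, hψ, by simp, fun _ h => h⟩
    · intro s t hst ht ψ hψ
      obtain ⟨ψ', h1, h2, h3⟩ := ht ψ hψ
      exact ⟨ψ', h1, fun x hx => h2 x (hst hx), h3⟩
    · intro s t hs ht ψ hψ
      obtain ⟨ψ₁, h1, h2, h3⟩ := hs ψ hψ
      obtain ⟨ψ₂, k1, k2, k3⟩ := ht ψ₁ h1
      exact ⟨ψ₂, k1, fun x hx => hx.elim (fun h => k3 x (h2 x h)) (k2 x),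
        fun x hx => k3 x (h3 x hx)⟩
    · intro x _
      obtain ⟨U, hU𝒰, hxU⟩ : ∃ U ∈ 𝒰, x ∈ U := by
        simpa using hcov.symm.subset (mem_univ x)
      obtain ⟨μ, -, hμ⟩ := (SmoothBumpFunction.nhds_basis_tsupport (I := 𝓡 n) x).mem_iff.1
        ((h𝒰 U hU𝒰).mem_nhds hxU)
      have hμr : ContMDiff (𝓡 n) 𝓘(ℝ, ℝ) r μ := μ.contMDiff.of_le hrω
      refine ⟨_, mem_nhdsWithin_of_mem_nhds μ.eventuallyEq_one, fun ψ hψ => ?_⟩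
      have hψ' : ContMDiff (𝓡 n) 𝓘(ℝ, ℝ) r (fun x => ψ x + (1 - ψ x) * μ x) := by
        have h : ContDiff ℝ r (fun p : ℝ × ℝ => p.1 + (1 - p.1) * p.2) := by fun_prop
        exact h.contMDiff.comp (hψ.1.prodMk_space hμr)
      -- This is `1` wherever `ψ` or `μ` is, and agrees with `ψ` off the support of `μ`.
      refine ⟨fun x => ψ x + (1 - ψ x) * μ x, ⟨hψ', ?_⟩, ?_, ?_⟩
      · filter_upwards [hψ.2, F.eventually_exists_mul_of_cutoff hr hrω hK hg hψ.1 hψ'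
          μ.hasCompactSupport (h𝒰 U hU𝒰) hμ
          fun x hx => by simp [image_eq_zero_of_notMem_tsupport hx]] with τ hτ hτ'
        obtain ⟨d, hdH, hd⟩ := hτ
        obtain ⟨e, he, hed⟩ := hτ'
        exact ⟨e * d, mul_mem (hH U hU𝒰 he) hdH, hed d hd⟩
      · intro x hx
        have : μ x = 1 := hx
        simp [this]
      · intro x hx
        simp [hx]
  obtain ⟨ψ, ⟨-, hψ⟩, hψK, -⟩ := main 0 ⟨contMDiff_const, Eventually.of_forall fun τ =>
    ⟨1, one_mem _, fun x => by simp [hg.map_zero]⟩⟩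
  filter_upwards [hψ] with τ ⟨d, hdH, hd⟩
  convert hdH
  refine Diffeomorph.ext fun x => ?_
  rw [hd]
  by_cases hx : x ∈ K
  · simp [hψK x hx]
  · rw [hg.eq_off _ x hx, hg.eq_off _ x hx]

theorem Foliation.group_le [IsManifold (𝓡 n) ∞ M]
    (F : Foliation n M r) (hr : r ≠ 0) (hrω : r ≤ ∞)
    {𝒰 : Set (Set M)} (h𝒰 : ∀ U ∈ 𝒰, IsOpen U) (hcov : ⋃₀ 𝒰 = univ)
    {H : Subgroup (Diffeomorph (𝓡 n) (𝓡 n) M M r)}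
    (hH : ∀ U ∈ 𝒰, isotopyComponent F.leafPreserving U ≤ H) : F.group ≤ H := by
  rintro _ ⟨K, hK, -, f, hf, rfl⟩
  have hloc : ∀ t, ∀ᶠ s in 𝓝 t, f s * (f t)⁻¹ ∈ H := by
    intro t
    have hg : IsIsotopyIn F.leafPreserving K (fun s => f (t + s) * (f t)⁻¹) := by
      refine ⟨?_, fun s => mul_mem (hf.mem _) (inv_mem (hf.mem _)), by simp, fun s x hx => ?_⟩
      · have h : ContMDiff (𝓘(ℝ, ℝ).prod (𝓡 n)) 𝓘(ℝ, ℝ) r (fun p : ℝ × M => t + p.1) :=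
          (contDiff_const.add contDiff_id : ContDiff ℝ r fun s : ℝ => t + s).contMDiff.comp
            contMDiff_fst
        exact hf.contMDiff.comp (h.prodMk ((f t).symm.contMDiff.comp contMDiff_snd))
      · have h : (f t)⁻¹ x = x := by
          rw [diffeo_inv_apply]
          conv_lhs => rw [← hf.eq_off t x hx]
          exact (f t).symm_apply_apply x
        rw [diffeo_mul_apply, h, hf.eq_off _ x hx]
    have h := F.eventually_mem_of_forall_isotopyComponent_le hr hrω h𝒰 hcov hH hK hg
    have hsub : Tendsto (fun s => s - t) (𝓝 t) (𝓝 0) := by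
      simpa using (continuous_sub_right t).tendsto t
    simpa using hsub.eventually h
  have hcoset : IsLocallyConstant
      (fun t => (Quotient.mk (QuotientGroup.rightRel H) (f t))) := by
    refine (IsLocallyConstant.iff_eventually_eq _).2 fun t => ?_
    filter_upwards [hloc t] with s hs
    exact Quotient.sound (by
      rw [← Quotient.eq_iff_equiv, Quotient.eq, QuotientGroup.rightRel_apply]
      simpa using inv_mem hs)
  have h := hcoset.apply_eq_of_isPreconnected isPreconnected_univ (mem_univ 0) (mem_univ 1)
  rw [Quotient.eq, QuotientGroup.rightRel_apply] at h
  simpa [hf.map_zero] using h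

end Fragmentation

end FoliatedManifold

theorem proposition2p11 (n : ℕ) (M : Type u) [TopologicalSpace M] [T2Space M]
    [ParacompactSpace M] [ChartedSpace (EuclideanSpace ℝ (Fin n)) M]
    [IsManifold (𝓡 n) ∞ M] (r : ℕ∞) (hr : 1 ≤ r)
    (F : FoliatedManifold.Foliation n M (r : ℕ∞ω)) :
    FoliatedManifold.IsFactorizable F.group := by
  intro 𝒰 h𝒰 hcov g hg
  have hr0 : (r : ℕ∞ω) ≠ 0 := by
    rintro h
    have : r = 0 := by exact_mod_cast h
    simp [this] at hr
  have hrtop : (r : ℕ∞ω) ≤ ∞ := by exact_mod_cast le_top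
  have : IsManifold (𝓡 n) (r : ℕ∞ω) M := IsManifold.of_le hrtop
  have hgH := F.group_le hr0 hrtop h𝒰 hcov
    (H := Subgroup.closure (⋃ U ∈ 𝒰,
      (FoliatedManifold.isotopyComponent F.leafPreserving U : Set _)))
    (fun U hU => fun x hx => Subgroup.subset_closure (Set.mem_biUnion hU hx)) hg
  rw [← Subgroup.mem_toSubmonoid, Subgroup.closure_toSubmonoid] at hgH
  obtain ⟨l, hl, rfl⟩ := Submonoid.exists_list_of_mem_closure hgH
  refine ⟨l, fun h hh => ?_, rfl⟩
  have hU : ∃ U ∈ 𝒰, h ∈ FoliatedManifold.isotopyComponent F.leafPreserving U := by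
    -- Either `h` or its inverse is a generator; both cases land in the same subgroup.
    rcases hl h hh with h1 | h1
    · simpa using h1
    · simpa using h1
  obtain ⟨U, hU, hU'⟩ := hU
  exact ⟨U, hU, FoliatedManifold.isotopyComponent_le_isotopyComponent_isotopyComponent _ _ hU'⟩
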